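/- \textbf{Definitions.} For $z\in\mathbb{C}$ with $\Re z>-1$ let $k_z(t)=t_+^z/\Gamma(z+1)$, where $t_+^z=t^z$ for $t>0$ and $t_+^z=0$ for $t\le 0$, and let the complex B-spline of degree $z$ be $$B_z(t)=\sum_{k\ge 0}(-1)^k\binom{z+1}{k}k_z(t-k),\qquad t\in\mathbb{R}$$ (a finite sum for each $t$). Let $\mathbb{R}_+=[0,\infty)$. For a real $d\times N$ matrix $M$ and $\boldsymbol z=(z_j)_j\in\mathbb{C}^N$ with all $\Re z_j>-1$, the complex box spline $\mathcal{B}_{\boldsymbol z}(\cdot|M)$ is the tempered distribution on $\mathbb{R}^d$ given by $$\langle \mathcal{B}_{\boldsymbol z}(\cdot|M),\varphi\rangle=\int_{\mathbb{R}_+^{N}}\prod_{j}B_{z_j}(t_j)\,\varphi(Mt)\,dt,\qquad \varphi\in\mathcal{S}(\mathbb{R}^d);$$ for $N=0$ this is the Dirac distribution at $0$. The translate of a tempered distribution $T$ by $a\in\mathbb{R}^d$ is $\langle\tau_aT,\varphi\rangle=\langle T,\varphi(\cdot+a)\rangle$. The convolution $S*T$ of tempered distributions on $\mathbb{R}^d$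 exists and equals the tempered distribution $U$ if $\langle S\otimes T,\ \eta_k(x,y)\varphi(x+y)\rangle\to\langle U,\varphi\rangle$ for every $\varphi\in\mathcal{S}(\mathbb{R}^d)$ and every sequence $\eta_k\in C_c^\infty(\mathbb{R}^{2d})$ all of whose derivatives are bounded uniformly in $k$ and which is eventually equal to $1$ on every compact set. \textbf{Theorem (Recurrence Formulas for Complex Box Splines).} Let $d,n\ge 0$ be integers and let $M=(m_0,\dots,m_n)$ be a real $d\times(n+1)$ matrix whose columns are non-zero and span $\mathbb{R}^d$. (i) Let $\boldsymbol z=(z_0,\dots,z_n)\in\mathbb{C}^{n+1}$ with $\Re z_j>-1$ for all $j$, let $\boldsymbol z\backslash z_n=(z_0,\dots,z_{n-1})$, and let $M\backslash m_n$ be the matrix $M$ with its last column removed. The integrals defining $\mathcal{B}_{\boldsymbol z}(\cdot|M)$ and $\mathcal{B}_{\boldsymbol z\backslash z_n}(\cdot|M\backslash m_n)$ converge absolutely and define tempered distributions, and $$\mathcal{B}_{\boldsymbol z}(\cdot|M)=\int_0^\infty B_{z_n}(u)\,\tau_{um_n}\mathcal{B}_{\boldsymbol z\backslash z_n}(\cdot|M\backslash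 m_n)\,du$$ as tempered distributions, that is, for every $\varphi\in\mathcal{S}(\mathbb{R}^d)$, $$\langle\mathcal{B}_{\boldsymbol z}(\cdot|M),\varphi\rangle=\int_0^\infty B_{z_n}(u)\,\langle\tau_{um_n}\mathcal{B}_{\boldsymbol z\backslash z_n}(\cdot|M\backslash m_n),\varphi\rangle\,du$$ with an absolutely convergent integral on the right. (ii) Let $\boldsymbol z,\overline{\boldsymbol z}\in\mathbb{C}^{n+1}$ be two arbitrary vectors (the bar does not denote complex conjugation) with $\Re z_j>-1$ and $\Re\overline{z}_j>-1$ for all $j$. Then the convolution of $\mathcal{B}_{\boldsymbol z}(\cdot|M)$ and $\mathcal{B}_{\overline{\boldsymbol z}}(\cdot|M)$ exists, and $$\mathcal{B}_{\boldsymbol z}(\cdot|M)*\mathcal{B}_{\overline{\boldsymbol z}}(\cdot|M)=\mathcal{B}_{\boldsymbol z+\overline{\boldsymbol z}+1}(\cdot|M),$$ where $\boldsymbol z+\overline{\boldsymbol z}+1=(z_j+\overline z_j+1)_{j=0}^n$. -/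

import Mathlib

open MeasureTheory Filter Topology
open scoped SchwartzMap ContDiff

noncomputable section

/-- Direction set: the columns of the matrix are non-zero and span the whole space. -/
def IsDirectionSet {d n : ℕ} (M : Matrix (Fin d) (Fin n) ℝ) : Prop :=
  (∀ j, M.col j ≠ 0) ∧ Submodule.span ℝ (Set.range M.col) = ⊤

/-- The normalized truncated complex power `k_z(t) = t_+^z / Γ(z+1)`, where `t_+^z` is `t^z` for
`t > 0` and `0` for `t ≤ 0`. -/
def truncPow (z : ℂ) (t : ℝ) : ℂ :=
  (if 0 < t then (t : ℂ) ^ z else 0) / Complex.Gamma (z + 1)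

/-- The complex backward difference of degree `w`,
`∇^w f (t) = ∑_{k ≥ 0} (-1)^k (w choose k) f(t - k)`. -/
def complexBackwardDiff (w : ℂ) (f : ℝ → ℂ) (t : ℝ) : ℂ :=
  ∑' k : ℕ, (-1 : ℂ) ^ k * Ring.choose w k * f (t - k)

/-- The complex B-spline `B_z = ∇^{z+1} k_z` (for each `t` the series has finitely many non-zero
terms, because `k_z` vanishes on `(-∞, 0]`). -/
def complexBSpline (z : ℂ) : ℝ → ℂ :=
  complexBackwardDiff (z + 1) (truncPow z)

/-- The tensor product B-spline `t ↦ ∏_j B_{z_j}(t_j)`. -/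
def tensorBSpline {n : ℕ} (z : Fin n → ℂ) (t : Fin n → ℝ) : ℂ :=
  ∏ j, complexBSpline (z j) (t j)

/-- `T` is the multivariate truncated power with weight `f` and matrix `M`: it is the tempered
distribution `φ ↦ ∫_{ℝ_+^n} f(t) φ(M t) dt`, all these integrals being absolutely convergent. -/
def IsWeightedTruncatedPower {d n : ℕ} (f : (Fin n → ℝ) → ℂ) (M : Matrix (Fin d) (Fin n) ℝ)
    (T : 𝓢'(EuclideanSpace ℝ (Fin d), ℂ)) : Prop :=
  ∀ φ : 𝓢(EuclideanSpace ℝ (Fin d), ℂ),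
    IntegrableOn (fun t : Fin n → ℝ => f t * φ (WithLp.toLp 2 (M.mulVec t))) (Set.Ici 0) volume ∧
      T φ = ∫ t in Set.Ici (0 : Fin n → ℝ), f t * φ (WithLp.toLp 2 (M.mulVec t))

open Classical in
/-- The multivariate truncated power `T_f(·|M)` with weight `f` as a tempered distribution
(`0` if the defining formula does not define a tempered distribution). -/
def weightedTruncatedPower {d n : ℕ} (f : (Fin n → ℝ) → ℂ) (M : Matrix (Fin d) (Fin n) ℝ) :
    𝓢'(EuclideanSpace ℝ (Fin d), ℂ) :=
  if h : ∃ T, IsWeightedTruncatedPower f M T then h.choose else 0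

/-- The complex box spline `𝓑_z(·|M)`, i.e. `⟨𝓑_z(·|M), φ⟩ = ∫_{ℝ_+^n} ∏_j B_{z_j}(t_j) φ(M t) dt`.
For an empty set of directions (`n = 0`) this is the Dirac distribution at the origin. -/
def complexBoxSpline {d n : ℕ} (z : Fin n → ℂ) (M : Matrix (Fin d) (Fin n) ℝ) :
    𝓢'(EuclideanSpace ℝ (Fin d), ℂ) :=
  weightedTruncatedPower (tensorBSpline z) M

section Distributions

variable {E : Type*} [NormedAddCommGroup E] [NormedSpace ℝ E]

/-- The translate `τ_a T` of a tempered distribution, `⟨τ_a T, φ⟩ = ⟨T, φ(· + a)⟩`. -/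
def distribTranslate (a : E) (T : 𝓢'(E, ℂ)) : 𝓢'(E, ℂ) :=
  PointwiseConvergenceCLM.precomp ℂ (SchwartzMap.compSubConstCLM ℂ (-a)) T

/-- `T` is the (weak) integral over `s` of the family `F` of tempered distributions:
`u ↦ ⟨F u, φ⟩` is integrable on `s` and `⟨T, φ⟩ = ∫_s ⟨F u, φ⟩ du` for all `φ`. -/
def IsDistribIntegral (s : Set ℝ) (F : ℝ → 𝓢'(E, ℂ)) (T : 𝓢'(E, ℂ)) : Prop :=
  ∀ φ : 𝓢(E, ℂ), IntegrableOn (fun u => F u φ) s volume ∧ T φ = ∫ u in s, F u φ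

/-- `W` is the tensor product `S ⊗ T`. -/
def IsDistribTensor (S T : 𝓢'(E, ℂ)) (W : 𝓢'(E × E, ℂ)) : Prop :=
  ∀ (φ ψ : 𝓢(E, ℂ)) (θ : 𝓢(E × E, ℂ)),
    (∀ x y, θ (x, y) = φ x * ψ y) → W θ = S φ * T ψ

/-- A sequence of compactly supported smooth functions converging to `1`: all derivatives are
bounded uniformly in `k`, and on every compact set the functions are eventually equal to `1`. -/
structure IsUnitSequence (η : ℕ → E × E → ℂ) : Prop where
  contDiff : ∀ k, ContDiff ℝ ∞ (η k)
  hasCompactSupport : ∀ k, HasCompactSupport (η k)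
  bounded : ∀ m : ℕ, ∃ C : ℝ, ∀ k p, ‖iteratedFDeriv ℝ m (η k) p‖ ≤ C
  eventually_one : ∀ K : Set (E × E), IsCompact K → ∀ᶠ k in atTop, ∀ p ∈ K, η k p = 1

theorem cutoff_hasCompactSupport {η : E × E → ℂ} (h : HasCompactSupport η) (φ : 𝓢(E, ℂ)) :
    HasCompactSupport (fun p : E × E => η p * φ (p.1 + p.2)) :=
  h.mul_right

theorem cutoff_contDiff {η : E × E → ℂ} (h : ContDiff ℝ ∞ η) (φ : 𝓢(E, ℂ)) :
    ContDiff ℝ ∞ (fun p : E × E => η p * φ (p.1 + p.2)) :=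
  h.mul ((φ.smooth ⊤).comp (contDiff_fst.add contDiff_snd))

/-- The convolution `S * T` of tempered distributions exists and equals `U`: for every `φ` and
every sequence `η_k` of compactly supported smooth functions on `E × E` converging to `1`,
`⟨S ⊗ T, η_k(x, y) φ(x + y)⟩ → ⟨U, φ⟩`. -/
def IsConvolution (S T U : 𝓢'(E, ℂ)) : Prop :=
  ∃ W : 𝓢'(E × E, ℂ), IsDistribTensor S T W ∧
    ∀ (η : ℕ → E × E → ℂ) (hη : IsUnitSequence η) (φ : 𝓢(E, ℂ)),
      Tendsto (fun k => W ((cutoff_hasCompactSupport (hη.hasCompactSupport k) φ).toSchwartzMap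
        (cutoff_contDiff (hη.contDiff k) φ))) atTop (𝓝 (U φ))

end Distributions

end

/-!
The heart of the matter is that the B-splines `B_z`, `Re z > -1`, are integrable on `ℝ` and form a
semigroup under convolution, `B_z * B_w = B_{z+w+1}`. Then `∏_j B_{z_j}(t_j)` is integrable on
`ℝ^n`, a box spline is the image of a finite complex measure under `t ↦ M t`
(`imageDistrib`), and the recurrence is Fubini's theorem. For the convolution, the tensor product
of two box splines is again integration against a finite complex measure, so the cutoffs disappear
by dominated convergence, and the semigroup property is applied in each coordinate.

*Semigroup property* (`integral_complexBSpline_mul_complexBSpline`). For fixed `t` only finitely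
many terms of the series matter. Truncated powers convolve by Euler's beta integral, and the
coefficients of `(1 - x)^(z+1)` and `(1 - x)^(w+1)` multiply by the Chu-Vandermonde identity.

*Integrability* (`integrable_complexBSpline`). By the semigroup property it suffices to treat
`B_{w-1}` with `0 < Re w < 1`. The coefficients `a_k = (-1)^k (w choose k)` of `(1 - x)^w` are
absolutely summable, but the truncated power `k_{w-1}` is not integrable at infinity. Let `c` be the
step function with value `(-1)^j (-w choose j)`, a coefficient of `(1 - x)^(-w)`, on `[j, j + 1)`.
Since `(1 - x)^w (1 - x)^(-w) = 1`, the sum `∑ a_k c(t - k)` is the indicator of `[0, 1)`. On the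
other hand `k_{w-1} - c` is `O(t^(Re w - 2))`, by the rate `O(1 / n)` in Euler's limit formula for
the Gamma function (`exists_norm_Gamma_sub_GammaSeq_le`), hence integrable. So `B_{w-1}` is the
indicator of `[0, 1)` plus an absolutely convergent series of translates of an integrable function.
-/

noncomputable section

/-! ### Binomial coefficients of complex degree -/

/-- The alternating binomial coefficients `(-1)^k (w choose k)`, i.e. the coefficients of
`(1 - x)^w`. -/
def altBinom (w : ℂ) (k : ℕ) : ℂ := (-1) ^ k * Ring.choose w k

theorem altBinom_eq_prod (w : ℂ) (k : ℕ) :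
    altBinom w k = (∏ j ∈ Finset.range k, (-w + j)) / k.factorial := by
  have h := Ring.descPochhammer_eq_factorial_smul_choose w k
  have h2 : (descPochhammer ℤ k).smeval w = ∏ j ∈ Finset.range k, (w - j) := by
    induction k with
    | zero => simp
    | succ k ih =>
      rw [Finset.prod_range_succ, ← ih (Ring.descPochhammer_eq_factorial_smul_choose w k),
        descPochhammer_succ_right, Polynomial.smeval_mul, Polynomial.smeval_sub,
        Polynomial.smeval_X, Polynomial.smeval_natCast]
      simp
  rw [h2, nsmul_eq_mul] at h
  have h3 : ∏ j ∈ Finset.range k, (-w + j) = (-1) ^ k * ∏ j ∈ Finset.range k, (w - j) := by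
    rw [← Finset.card_range k, ← Finset.prod_const, Finset.card_range, ← Finset.prod_mul_distrib]
    exact Finset.prod_congr rfl fun j _ => by ring
  rw [altBinom, h3, h, eq_div_iff (by exact_mod_cast k.factorial_ne_zero)]
  ring

/-- The Chu-Vandermonde identity: `(1 - x)^w (1 - x)^v = (1 - x)^(w + v)`. -/
theorem sum_antidiagonal_altBinom (w v : ℂ) (k : ℕ) :
    ∑ p ∈ Finset.HasAntidiagonal.antidiagonal k, altBinom w p.1 * altBinom v p.2 =
      altBinom (w + v) k := by
  simp only [altBinom, Ring.add_choose_eq k (Commute.all w v), Finset.mul_sum]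
  refine Finset.sum_congr rfl fun p hp => ?_
  rw [← Finset.HasAntidiagonal.mem_antidiagonal.1 hp, pow_add]
  ring

theorem altBinom_zero_left (k : ℕ) : altBinom 0 k = if k = 0 then 1 else 0 := by
  rw [altBinom, Ring.choose_zero_ite]
  split_ifs with h <;> simp [h]

/-- The alternating binomial coefficients in terms of the sequence in Euler's limit formula for
`Γ(-w)`; with that formula, `(-1)^k (w choose k)` is asymptotically `k^(-w-1) / Γ(-w)`. -/
theorem altBinom_succ_eq (w : ℂ) {n : ℕ} (hn : n ≠ 0) :
    altBinom w (n + 1) = (Complex.GammaSeq (-w) n)⁻¹ * (n : ℂ) ^ (-w) / (n + 1) := by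
  have h1 : ((n + 1 : ℕ).factorial : ℂ) = (n + 1) * n.factorial := by
    push_cast [Nat.factorial_succ]; rfl
  have h2 : (n.factorial : ℂ) ≠ 0 := by exact_mod_cast n.factorial_ne_zero
  have h3 : (n : ℂ) ^ (-w) ≠ 0 := by simp [Complex.cpow_eq_zero_iff, hn]
  have h4 : (n + 1 : ℂ) ≠ 0 := by exact_mod_cast n.succ_ne_zero
  rw [altBinom_eq_prod, Complex.GammaSeq, inv_div, h1]
  field_simp

/-! ### Growth of binomial coefficients -/

theorem exists_norm_inv_GammaSeq_le (s : ℂ) :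
    ∃ C : ℝ, ∀ n : ℕ, ‖(Complex.GammaSeq s n)⁻¹‖ ≤ C := by
  by_cases hs : Complex.Gamma s = 0
  · -- at a pole of `Γ` the product in the denominator of `GammaSeq` vanishes eventually, and so
    -- does the inverse, by the convention on division by zero
    obtain ⟨m, hm⟩ := (Complex.Gamma_eq_zero_iff _).1 hs
    have h : Tendsto (fun n => (Complex.GammaSeq s n)⁻¹) atTop (𝓝 0) := by
      refine tendsto_const_nhds.congr' ?_
      filter_upwards [eventually_ge_atTop m] with n hn
      have : ∏ j ∈ Finset.range (n + 1), (s + (j : ℂ)) = 0 :=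
        Finset.prod_eq_zero (Finset.mem_range.2 (Nat.lt_succ_of_le hn)) (by rw [hm]; ring)
      simp [Complex.GammaSeq, this]
    obtain ⟨C, hC⟩ := h.norm.bddAbove_range
    exact ⟨C, fun n => hC ⟨n, rfl⟩⟩
  · obtain ⟨C, hC⟩ := ((Complex.GammaSeq_tendsto_Gamma s).inv₀ hs).norm.bddAbove_range
    exact ⟨C, fun n => hC ⟨n, rfl⟩⟩

theorem exists_norm_altBinom_le (w : ℂ) :
    ∃ C : ℝ, ∀ n : ℕ, 1 ≤ n → ‖altBinom w (n + 1)‖ ≤ C * (n : ℝ) ^ (-w.re - 1) := by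
  obtain ⟨C, hC⟩ := exists_norm_inv_GammaSeq_le (-w)
  refine ⟨C, fun n hn => ?_⟩
  have hn0 : (0 : ℝ) < n := by exact_mod_cast hn
  have h1 : ‖(n + 1 : ℂ)‖ = n + 1 := by
    rw [← Nat.cast_succ, Complex.norm_natCast]; push_cast; rfl
  have h2 : ‖(n : ℂ) ^ (-w)‖ = (n : ℝ) ^ (-w.re) := by
    have := Complex.norm_cpow_eq_rpow_re_of_pos hn0 (-w)
    simpa using this
  rw [altBinom_succ_eq w (by omega), norm_div, norm_mul, h1, h2, Real.rpow_sub_one hn0.ne',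
    ← mul_div_assoc]
  have hC0 : 0 ≤ C := (norm_nonneg _).trans (hC 0)
  gcongr
  · exact hC n
  · linarith

theorem summable_norm_altBinom {w : ℂ} (hw : 0 < w.re) : Summable fun k => ‖altBinom w k‖ := by
  obtain ⟨C, hC⟩ := exists_norm_altBinom_le w
  have h : Summable fun n : ℕ => C * ((n + 1 : ℕ) : ℝ) ^ (-w.re - 1) :=
    (((summable_nat_add_iff 1).2 (Real.summable_nat_rpow.2 (by linarith)))).mul_left C
  exact (summable_nat_add_iff 2).1
    (h.of_nonneg_of_le (fun _ => norm_nonneg _) fun n => hC (n + 1) (by omega))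

/-- Mean value bound for complex powers of positive reals, for exponents of real part at most
`1`. -/
theorem norm_cpow_sub_cpow_le {s : ℂ} (hs : s.re ≤ 1) {a b : ℝ} (ha : 0 < a) (hab : a ≤ b) :
    ‖(b : ℂ) ^ s - (a : ℂ) ^ s‖ ≤ ‖s‖ * a ^ (s.re - 1) * (b - a) := by
  have hd : ∀ x ∈ Set.Icc a b, HasDerivWithinAt (fun x : ℝ => (x : ℂ) ^ s)
      (s * (x : ℂ) ^ (s - 1)) (Set.Icc a b) x := by
    intro x hx
    have hx0 : 0 < x := ha.trans_le hx.1
    have := ((hasDerivAt_id (x : ℂ)).cpow_const (c := s) (by simp [hx0])).comp_ofReal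
    simpa using this.hasDerivWithinAt
  have := (convex_Icc a b).norm_image_sub_le_of_norm_hasDerivWithin_le
    (C := ‖s‖ * a ^ (s.re - 1)) hd (fun x hx => ?_) (Set.left_mem_Icc.2 hab)
    (Set.right_mem_Icc.2 hab)
  · rwa [Real.norm_of_nonneg (sub_nonneg.2 hab)] at this
  · have hx0 : 0 < x := ha.trans_le hx.1
    rw [norm_mul, Complex.norm_cpow_eq_rpow_re_of_pos hx0]
    gcongr
    exact Real.rpow_le_rpow_of_nonpos ha hx.1 (by simpa using hs)

/-- Second order Taylor bound for `(1 + x)^w`. -/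
theorem norm_one_add_cpow_sub_le {w : ℂ} (hw : w.re ≤ 2) {x : ℝ} (hx : 0 ≤ x) :
    ‖((1 + x : ℝ) : ℂ) ^ w - 1 - w * x‖ ≤ ‖w‖ * ‖w - 1‖ * x ^ 2 := by
  have hd : ∀ y ∈ Set.Icc 0 x, HasDerivWithinAt
      (fun y : ℝ => ((1 + y : ℝ) : ℂ) ^ w - 1 - w * y)
      (w * (((1 + y : ℝ) : ℂ) ^ (w - 1) - 1)) (Set.Icc 0 x) y := by
    intro y hy
    have hy0 : 0 < 1 + y := by linarith [hy.1]
    have h1 := (((hasDerivAt_id (y : ℂ)).const_add 1).cpow_const (c := w)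
      (Or.inl (by simpa using hy0))).comp_ofReal
    have h2 := ((h1.sub_const 1).sub ((hasDerivAt_id (y : ℂ)).const_mul w).comp_ofReal)
    refine (h2.hasDerivWithinAt.congr_deriv (by simp [mul_sub])).congr_of_mem (fun y _ => ?_) hy
    simp
  have := (convex_Icc 0 x).norm_image_sub_le_of_norm_hasDerivWithin_le
    (C := ‖w‖ * (‖w - 1‖ * x)) hd (fun y hy => ?_) (Set.left_mem_Icc.2 hx)
    (Set.right_mem_Icc.2 hx)
  · simp only [add_zero, Complex.ofReal_one, Complex.one_cpow, sub_self, Complex.ofReal_zero,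
      mul_zero, sub_zero, Real.norm_of_nonneg hx] at this
    calc _ ≤ _ := this
      _ = _ := by ring
  · have h := norm_cpow_sub_cpow_le (s := w - 1) (by simp; linarith) one_pos
      (show 1 ≤ 1 + y by linarith [hy.1])
    simp only [Complex.ofReal_one, Complex.one_cpow, Real.one_rpow, mul_one,
      add_sub_cancel_left] at h
    rw [norm_mul]
    gcongr
    exact h.trans (by gcongr; exact hy.2)

/-- A convergent sequence whose increments are `O(1 / n^2)` approaches its limit at rate
`O(1 / n)`. -/
theorem norm_sub_le_of_norm_succ_sub_le {u : ℕ → ℂ} {l : ℂ} {C : ℝ}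
    (hu : Tendsto u atTop (𝓝 l))
    (h : ∀ n : ℕ, 1 ≤ n → ‖u (n + 1) - u n‖ ≤ C / (n * (n + 1))) {n : ℕ} (hn : 1 ≤ n) :
    ‖l - u n‖ ≤ C / n := by
  have hn0 : (0 : ℝ) < n := by exact_mod_cast hn
  have hC : 0 ≤ C := by
    have := (norm_nonneg _).trans (h n hn)
    by_contra! hneg
    exact absurd this (not_le.2 (div_neg_of_neg_of_pos hneg (by positivity)))
  have key : ∀ m : ℕ, ‖u (n + m) - u n‖ ≤ C * (1 / n - 1 / (n + m : ℕ)) := by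
    intro m
    induction m with
    | zero => simp
    | succ m ih =>
      have h1 := h (n + m) (by omega)
      have h2 : u (n + (m + 1)) - u n = (u (n + m + 1) - u (n + m)) + (u (n + m) - u n) := by
        rw [← add_assoc]; ring
      have h3 : C / ((n + m : ℕ) * ((n + m : ℕ) + 1)) =
          C * (1 / (n + m : ℕ) - 1 / (n + (m + 1) : ℕ)) := by
        have : (0 : ℝ) < n + m := by positivity
        push_cast
        field_simp
        ring
      rw [h2]
      refine (norm_add_le _ _).trans ?_
      rw [h3] at h1
      linarith
  have hlim : Tendsto (fun m => ‖u (n + m) - u n‖) atTop (𝓝 ‖l - u n‖) := by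
    have : Tendsto (fun m => u (n + m)) atTop (𝓝 l) := by
      simpa [add_comm] using (tendsto_add_atTop_iff_nat n).2 hu
    exact (this.sub_const _).norm
  refine le_of_tendsto' hlim fun m => (key m).trans ?_
  rw [div_eq_mul_one_div C]
  gcongr
  have : (0 : ℝ) ≤ 1 / (n + m : ℕ) := by positivity
  linarith

/-- Rate of convergence in Euler's limit formula for the Gamma function. -/
theorem exists_norm_Gamma_sub_GammaSeq_le {w : ℂ} (hw : 0 < w.re) (hw2 : w.re ≤ 2) :
    ∃ C : ℝ, ∀ n : ℕ, 1 ≤ n → ‖Complex.Gamma w - Complex.GammaSeq w n‖ ≤ C / n := by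
  obtain ⟨G, hG⟩ := (Complex.GammaSeq_tendsto_Gamma w).norm.bddAbove_range
  have hG' : ∀ n, ‖Complex.GammaSeq w n‖ ≤ G := fun n => hG ⟨n, rfl⟩
  have hG0 : 0 ≤ G := (norm_nonneg _).trans (hG' 0)
  refine ⟨G * (2 * (‖w‖ * ‖w - 1‖) + ‖w‖), fun n hn =>
    norm_sub_le_of_norm_succ_sub_le (Complex.GammaSeq_tendsto_Gamma w) (fun n hn => ?_) hn⟩
  have hn0 : (0 : ℝ) < n := by exact_mod_cast hn
  have hnc : (n : ℂ) ≠ 0 := by exact_mod_cast hn0.ne'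
  have hn1 : (n + 1 : ℂ) ≠ 0 := by exact_mod_cast n.succ_ne_zero
  have hwn : w + (n + 1) ≠ 0 := fun h => by
    have := congrArg Complex.re h
    simp at this
    linarith
  have hpow : ((n + 1 : ℕ) : ℂ) ^ w = (n : ℂ) ^ w * ((1 + (n : ℝ)⁻¹ : ℝ) : ℂ) ^ w := by
    rw [← Complex.ofReal_natCast n, ← Complex.mul_cpow_ofReal_nonneg hn0.le (by positivity)]
    congr 1
    push_cast
    field_simp
  have hrec : Complex.GammaSeq w (n + 1) = Complex.GammaSeq w n *
      ((n + 1) / (w + (n + 1)) * ((1 + (n : ℝ)⁻¹ : ℝ) : ℂ) ^ w) := by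
    rw [Complex.GammaSeq, Complex.GammaSeq, hpow, Finset.prod_range_succ _ (n + 1),
      Nat.factorial_succ]
    push_cast
    rw [mul_comm (∏ j ∈ Finset.range (n + 1), (w + (j : ℂ))), ← div_div, mul_div_assoc]
    ring
  have hsub : Complex.GammaSeq w (n + 1) - Complex.GammaSeq w n = Complex.GammaSeq w n *
      ((n + 1) / (w + (n + 1)) * ((((1 + (n : ℝ)⁻¹ : ℝ) : ℂ) ^ w - 1 - w * ((n : ℝ)⁻¹ : ℝ)) +
        w * (1 / (n * (n + 1))))) := by
    rw [hrec]
    generalize ((1 + (n : ℝ)⁻¹ : ℝ) : ℂ) ^ w = P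
    push_cast
    field_simp
    ring
  have hfrac : ‖(n + 1 : ℂ) / (w + (n + 1))‖ ≤ 1 := by
    rw [norm_div]
    refine div_le_one_of_le₀ ?_ (norm_nonneg _)
    calc ‖(n + 1 : ℂ)‖ = n + 1 := by
          rw [← Nat.cast_succ, Complex.norm_natCast]; push_cast; rfl
      _ ≤ (w + (n + 1)).re := by simp; linarith
      _ ≤ _ := Complex.re_le_norm _
  have hT := norm_one_add_cpow_sub_le hw2 (x := (n : ℝ)⁻¹) (by positivity)
  have hsq : ((n : ℝ)⁻¹) ^ 2 ≤ 2 * (1 / (n * (n + 1))) := by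
    have h1 : (1 : ℝ) ≤ n := by exact_mod_cast hn
    rw [inv_pow, ← one_div, mul_one_div, div_le_div_iff₀ (by positivity) (by positivity)]
    nlinarith
  have hlast : ‖w * (1 / ((n : ℂ) * (n + 1)))‖ = ‖w‖ * (1 / (n * (n + 1))) := by
    rw [norm_mul, norm_div, norm_mul, norm_one, ← Nat.cast_succ, Complex.norm_natCast,
      Complex.norm_natCast]
    push_cast
    rfl
  rw [hsub, norm_mul, norm_mul]
  calc _ ≤ G * (1 * (‖w‖ * ‖w - 1‖ * (2 * (1 / (n * (n + 1)))) + ‖w‖ * (1 / (n * (n + 1))))) := by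
        gcongr
        · exact hG' n
        · refine (norm_add_le _ _).trans (add_le_add (hT.trans (by gcongr)) hlast.le)
    _ = _ := by ring

/-- The power function `t^(w-1)` is approximated, up to an error integrable at infinity when
`w.re < 1`, by a step function formed from the coefficients of `(1 - x)^(-w)`. -/
theorem exists_norm_cpow_sub_altBinom_le {w : ℂ} (hw : 0 < w.re) (hw1 : w.re < 1) :
    ∃ C : ℝ, ∀ t : ℝ, 1 ≤ t →
      ‖(t : ℂ) ^ (w - 1) - Complex.Gamma w * altBinom (-w) ⌊t⌋₊‖ ≤ C * t ^ (w.re - 2) := by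
  obtain ⟨C, hC⟩ := exists_norm_Gamma_sub_GammaSeq_le hw (by linarith)
  have key : ∀ n : ℕ, 1 ≤ n → altBinom (-w) n * Complex.GammaSeq w n = (n : ℂ) ^ w / (w + n) := by
    intro n hn
    have hp : ∏ j ∈ Finset.range n, (w + (j : ℂ)) ≠ 0 := Finset.prod_ne_zero_iff.2 fun j _ h => by
      have := congrArg Complex.re h
      simp at this
      linarith [(Nat.cast_nonneg j : (0 : ℝ) ≤ j)]
    have h2 : (n.factorial : ℂ) ≠ 0 := by exact_mod_cast n.factorial_ne_zero
    rw [altBinom_eq_prod, Complex.GammaSeq, Finset.prod_range_succ, neg_neg]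
    field_simp
  obtain ⟨G, hG⟩ := exists_norm_inv_GammaSeq_le w
  have hG0 : 0 ≤ G := (norm_nonneg _).trans (hG 0)
  have hC0 : 0 ≤ C := by simpa using (norm_nonneg _).trans (hC 1 le_rfl)
  refine ⟨(‖w - 1‖ + ‖w‖ + G * C) * (1 / 2 : ℝ) ^ (w.re - 2), fun t ht => ?_⟩
  set n := ⌊t⌋₊ with hn_def
  have hn : 1 ≤ n := (Nat.one_le_floor_iff t).2 ht
  have hn1 : (1 : ℝ) ≤ n := by exact_mod_cast hn
  have hn0 : (0 : ℝ) < n := by linarith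
  have hnt : (n : ℝ) ≤ t := Nat.floor_le (by linarith)
  have htn : t < n + 1 := Nat.lt_floor_add_one t
  have hnc : (n : ℂ) ≠ 0 := by exact_mod_cast hn0.ne'
  have hwn : (n : ℝ) ≤ ‖w + n‖ :=
    calc (n : ℝ) ≤ (w + n).re := by simp; linarith
      _ ≤ _ := Complex.re_le_norm _
  have hwn0 : w + n ≠ 0 := norm_pos_iff.1 (hn0.trans_le hwn)
  have hnw : ‖(n : ℂ) ^ w‖ = (n : ℝ) ^ w.re := by
    simpa using Complex.norm_cpow_eq_rpow_re_of_pos hn0 w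
  have hseq0 : Complex.GammaSeq w n ≠ 0 := by
    intro h0
    have := key n hn
    rw [h0, mul_zero, eq_comm, div_eq_zero_iff, Complex.cpow_eq_zero_iff] at this
    simp [hnc, hwn0] at this
  have hc : altBinom (-w) n = (n : ℂ) ^ w / (w + n) * (Complex.GammaSeq w n)⁻¹ := by
    rw [← key n hn, mul_inv_cancel_right₀ hseq0]
  have hc_le : ‖altBinom (-w) n‖ ≤ (n : ℝ) ^ w.re / n * G := by
    rw [hc, norm_mul, norm_div, hnw]
    gcongr
    exact hG n
  have hexp : (n : ℝ) ^ (w.re - 2) = (n : ℝ) ^ w.re / n / n := by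
    rw [Real.rpow_sub hn0, Real.rpow_two, sq, div_div]
  have h1 : ‖(t : ℂ) ^ (w - 1) - (n : ℂ) ^ (w - 1)‖ ≤ ‖w - 1‖ * (n : ℝ) ^ (w.re - 2) := by
    have := norm_cpow_sub_cpow_le (s := w - 1) (by simp; linarith) hn0 hnt
    simp only [Complex.ofReal_natCast, Complex.sub_re, Complex.one_re, sub_sub] at this
    norm_num at this
    refine this.trans (mul_le_of_le_one_right (by positivity) (by linarith))
  have h2 : ‖(n : ℂ) ^ (w - 1) - (n : ℂ) ^ w / (w + n)‖ ≤ ‖w‖ * (n : ℝ) ^ (w.re - 2) := by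
    have : (n : ℂ) ^ (w - 1) - (n : ℂ) ^ w / (w + n) = w * ((n : ℂ) ^ w / n / (w + n)) := by
      rw [Complex.cpow_sub _ _ hnc, Complex.cpow_one]
      field_simp
      ring
    rw [this, norm_mul, norm_div, norm_div, hnw, hexp, Complex.norm_natCast]
    gcongr
  have h3 : ‖altBinom (-w) n * (Complex.GammaSeq w n - Complex.Gamma w)‖ ≤
      G * C * (n : ℝ) ^ (w.re - 2) := by
    rw [norm_mul, norm_sub_rev, hexp]
    calc _ ≤ (n : ℝ) ^ w.re / n * G * (C / n) := by gcongr; exact hC n hn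
      _ = _ := by ring
  have hhalf : (n : ℝ) ^ (w.re - 2) ≤ (1 / 2 : ℝ) ^ (w.re - 2) * t ^ (w.re - 2) := by
    rw [← Real.mul_rpow (by norm_num) (by linarith)]
    exact Real.rpow_le_rpow_of_nonpos (by linarith) (by linarith) (by linarith)
  have hsplit : (t : ℂ) ^ (w - 1) - Complex.Gamma w * altBinom (-w) n =
      ((t : ℂ) ^ (w - 1) - (n : ℂ) ^ (w - 1)) + ((n : ℂ) ^ (w - 1) - (n : ℂ) ^ w / (w + n)) +
        altBinom (-w) n * (Complex.GammaSeq w n - Complex.Gamma w) := by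
    rw [← key n hn]
    ring
  calc _ ≤ ‖w - 1‖ * (n : ℝ) ^ (w.re - 2) + ‖w‖ * (n : ℝ) ^ (w.re - 2) +
        G * C * (n : ℝ) ^ (w.re - 2) := by
        rw [hsplit]
        exact norm_add₃_le.trans (add_le_add (add_le_add h1 h2) h3)
    _ = (‖w - 1‖ + ‖w‖ + G * C) * (n : ℝ) ^ (w.re - 2) := by ring
    _ ≤ (‖w - 1‖ + ‖w‖ + G * C) * ((1 / 2 : ℝ) ^ (w.re - 2) * t ^ (w.re - 2)) := by gcongr
    _ = _ := by ring

/-! ### Truncated powers and the convolution of B-splines -/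

theorem truncPow_of_nonpos (z : ℂ) {t : ℝ} (ht : t ≤ 0) : truncPow z t = 0 := by
  simp [truncPow, not_lt.2 ht]

theorem truncPow_of_pos (z : ℂ) {t : ℝ} (ht : 0 < t) :
    truncPow z t = (t : ℂ) ^ z / Complex.Gamma (z + 1) := by
  simp [truncPow, ht]

theorem measurable_truncPow (z : ℂ) : Measurable (truncPow z) :=
  (Measurable.ite measurableSet_Ioi (Complex.measurable_ofReal.pow_const z)
    measurable_const).div_const _

theorem hasSum_complexBSpline (z : ℂ) {t : ℝ} {N : ℕ} (ht : t ≤ N) :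
    HasSum (fun k : ℕ => altBinom (z + 1) k * truncPow z (t - k))
      (∑ k ∈ Finset.range N, altBinom (z + 1) k * truncPow z (t - k)) := by
  refine hasSum_sum_of_ne_finset_zero fun k hk => ?_
  have hNk : (N : ℝ) ≤ k := by exact_mod_cast not_lt.1 (Finset.mem_range.not.1 hk)
  rw [truncPow_of_nonpos z (by linarith), mul_zero]

theorem complexBSpline_eq_sum (z : ℂ) {t : ℝ} {N : ℕ} (ht : t ≤ N) :
    complexBSpline z t = ∑ k ∈ Finset.range N, altBinom (z + 1) k * truncPow z (t - k) :=
  (hasSum_complexBSpline z ht).tsum_eq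

theorem complexBSpline_of_nonpos (z : ℂ) {t : ℝ} (ht : t ≤ 0) : complexBSpline z t = 0 := by
  simpa using complexBSpline_eq_sum z (N := 0) (by simpa using ht)

theorem Complex.betaIntegral_ne_zero {u v : ℂ} (hu : 0 < u.re) (hv : 0 < v.re) :
    Complex.betaIntegral u v ≠ 0 := fun h => by
  have := Complex.Gamma_mul_Gamma_eq_betaIntegral hu hv
  rw [h, mul_zero, mul_eq_zero] at this
  exact this.elim (Complex.Gamma_ne_zero_of_re_pos hu) (Complex.Gamma_ne_zero_of_re_pos hv)

theorem truncPow_mul_truncPow_sub (z w : ℂ) (t s : ℝ) :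
    truncPow z s * truncPow w (t - s) = (Set.Ioo 0 t).indicator
      (fun s : ℝ => (s : ℂ) ^ z * ((t : ℂ) - s) ^ w /
        (Complex.Gamma (z + 1) * Complex.Gamma (w + 1))) s := by
  by_cases hs : s ∈ Set.Ioo 0 t
  · rw [Set.indicator_of_mem hs, truncPow_of_pos z hs.1, truncPow_of_pos w (sub_pos.2 hs.2),
      Complex.ofReal_sub, div_mul_div_comm]
  · rw [Set.indicator_of_notMem hs]
    rcases le_or_gt s 0 with h | h
    · rw [truncPow_of_nonpos z h, zero_mul]
    · rw [truncPow_of_nonpos w (sub_nonpos.2 (not_lt.1 fun h' => hs ⟨h, h'⟩)), mul_zero]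

/-- Truncated powers form a semigroup under convolution: this is Euler's beta integral. -/
theorem integral_truncPow_mul_truncPow {z w : ℂ} (hz : -1 < z.re) (hw : -1 < w.re) (t : ℝ) :
    ∫ s, truncPow z s * truncPow w (t - s) = truncPow (z + w + 1) t := by
  simp_rw [truncPow_mul_truncPow_sub]
  rw [integral_indicator measurableSet_Ioo, ← integral_Ioc_eq_integral_Ioo]
  rcases le_or_gt t 0 with ht | ht
  · rw [Set.Ioc_eq_empty (not_lt.2 ht), truncPow_of_nonpos _ ht]
    simp
  · have hz' : 0 < (z + 1).re := by simp; linarith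
    have hw' : 0 < (w + 1).re := by simp; linarith
    have h := Complex.betaIntegral_scaled (z + 1) (w + 1) ht
    simp only [add_sub_cancel_right] at h
    rw [← intervalIntegral.integral_of_le ht.le, intervalIntegral.integral_div, h,
      Complex.Gamma_mul_Gamma_eq_betaIntegral hz' hw', truncPow_of_pos _ ht,
      mul_div_mul_right _ _ (Complex.betaIntegral_ne_zero hz' hw')]
    congr 2 <;> ring

theorem integrable_truncPow_mul_truncPow {z w : ℂ} (hz : -1 < z.re) (hw : -1 < w.re) (t : ℝ) :
    Integrable fun s => truncPow z s * truncPow w (t - s) := by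
  rcases le_or_gt t 0 with ht | ht
  · simp_rw [truncPow_mul_truncPow_sub, Set.Ioo_eq_empty (not_lt.2 ht), Set.indicator_empty]
    exact integrable_zero _ _ _
  · -- a function with non-zero Bochner integral is integrable
    refine Integrable.of_integral_ne_zero ?_
    rw [integral_truncPow_mul_truncPow hz hw, truncPow_of_pos _ ht]
    refine div_ne_zero ?_ (Complex.Gamma_ne_zero_of_re_pos (by simp; linarith))
    simp [Complex.cpow_eq_zero_iff, ht.ne']

/-- B-splines form a semigroup under convolution: the truncated powers do, and the coefficients
are combined by the Chu-Vandermonde identity. -/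
theorem integral_complexBSpline_mul_complexBSpline {z w : ℂ} (hz : -1 < z.re) (hw : -1 < w.re)
    (t : ℝ) :
    ∫ s, complexBSpline z s * complexBSpline w (t - s) = complexBSpline (z + w + 1) t := by
  obtain ⟨N, hN⟩ := exists_nat_ge t
  have hprod : ∀ s, complexBSpline z s * complexBSpline w (t - s) =
      ∑ p ∈ Finset.range N ×ˢ Finset.range N, altBinom (z + 1) p.1 * altBinom (w + 1) p.2 *
        (truncPow z (s - p.1) * truncPow w (t - p.1 - p.2 - (s - p.1))) := by
    intro s
    have hrw : ∑ p ∈ Finset.range N ×ˢ Finset.range N,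
        altBinom (z + 1) p.1 * altBinom (w + 1) p.2 *
          (truncPow z (s - p.1) * truncPow w (t - p.1 - p.2 - (s - p.1))) =
        (∑ k ∈ Finset.range N, altBinom (z + 1) k * truncPow z (s - k)) *
          ∑ l ∈ Finset.range N, altBinom (w + 1) l * truncPow w (t - s - l) := by
      rw [Finset.sum_mul_sum, ← Finset.sum_product']
      refine Finset.sum_congr rfl fun p _ => ?_
      rw [show t - p.1 - p.2 - (s - p.1) = t - s - p.2 by ring]
      ring
    rw [hrw]
    rcases le_or_gt s 0 with h0 | h0
    · rw [complexBSpline_of_nonpos z h0, ← complexBSpline_eq_sum z (h0.trans N.cast_nonneg),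
        complexBSpline_of_nonpos z h0, zero_mul, zero_mul]
    rcases le_or_gt t s with h1 | h1
    · rw [complexBSpline_of_nonpos w (sub_nonpos.2 h1),
        ← complexBSpline_eq_sum w ((sub_nonpos.2 h1).trans N.cast_nonneg),
        complexBSpline_of_nonpos w (sub_nonpos.2 h1), mul_zero, mul_zero]
    · rw [complexBSpline_eq_sum z (h1.le.trans hN), complexBSpline_eq_sum w (by linarith)]
  simp_rw [hprod]
  rw [integral_finsetSum _ fun p _ => ((integrable_truncPow_mul_truncPow hz hw
    (t - p.1 - p.2)).comp_sub_right (p.1 : ℝ)).const_mul _]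
  have hint : ∀ p : ℕ × ℕ, ∫ s : ℝ, altBinom (z + 1) p.1 * altBinom (w + 1) p.2 *
      (truncPow z (s - p.1) * truncPow w (t - p.1 - p.2 - (s - p.1))) =
      altBinom (z + 1) p.1 * altBinom (w + 1) p.2 *
        truncPow (z + w + 1) (t - (p.1 + p.2 : ℕ)) := by
    intro p
    rw [integral_const_mul, integral_sub_right_eq_self
      (fun s => truncPow z s * truncPow w (t - p.1 - p.2 - s)) (p.1 : ℝ),
      integral_truncPow_mul_truncPow hz hw, Nat.cast_add, sub_sub]
  simp_rw [hint]
  rw [complexBSpline_eq_sum _ hN]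
  -- pairs with `N ≤ p.1 + p.2` do not contribute; the others are grouped by their sum
  rw [← Finset.sum_filter_of_ne (p := fun p : ℕ × ℕ => p.1 + p.2 ∈ Finset.range N),
    ← Finset.sum_fiberwise_of_maps_to (g := fun p : ℕ × ℕ => p.1 + p.2)
      (t := Finset.range N) (fun p hp => (Finset.mem_filter.1 hp).2)]
  · refine Finset.sum_congr rfl fun m hm => ?_
    have hm' := Finset.mem_range.1 hm
    rw [show z + w + 1 + 1 = (z + 1) + (w + 1) by ring, ← sum_antidiagonal_altBinom,
      Finset.sum_mul]
    refine Finset.sum_congr ?_ fun p hp => ?_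
    · ext p
      simp only [Finset.mem_filter, Finset.mem_product, Finset.mem_range,
        Finset.HasAntidiagonal.mem_antidiagonal]
      omega
    · rw [Finset.HasAntidiagonal.mem_antidiagonal.1 hp]
  · intro p _ hp
    by_contra hlt
    have : (N : ℝ) ≤ (p.1 + p.2 : ℕ) := by
      exact_mod_cast not_lt.1 (Finset.mem_range.not.1 hlt)
    exact hp (by rw [truncPow_of_nonpos _ (by linarith), mul_zero])

/-! ### Integrability of B-splines -/

theorem integrable_of_hasSum {α : Type*} [MeasurableSpace α] {μ : Measure α} {F : ℕ → α → ℂ}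
    {f : α → ℂ} (hF : ∀ k, Integrable (F k) μ) (hs : Summable fun k => ∫ x, ‖F k x‖ ∂μ)
    (h : ∀ x, HasSum (fun k => F k x) (f x)) : Integrable f μ := by
  refine ⟨aestronglyMeasurable_of_tendsto_ae atTop
    (f := fun N x => ∑ k ∈ Finset.range N, F k x)
    (fun N => (integrable_finsetSum _ fun k _ => hF k).1)
    (ae_of_all _ fun x => (h x).tendsto_sum_nat), ?_⟩
  have hle : ∫⁻ x, ‖f x‖ₑ ∂μ ≤ ∑' k, ∫⁻ x, ‖F k x‖ₑ ∂μ := by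
    rw [← lintegral_tsum fun k => (hF k).1.enorm]
    refine lintegral_mono fun x => ?_
    rw [← (h x).tsum_eq]
    exact enorm_tsum_le_tsum_enorm
  refine hle.trans_lt (lt_top_iff_ne_top.2 ?_)
  simp_rw [← ofReal_integral_norm_eq_lintegral_enorm (hF _)]
  exact hs.tsum_ofReal_ne_top

/-- The step function whose values on the intervals `[j, j + 1)` are the coefficients
`(-1)^j (-w choose j)` of the power series `(1 - x)^(-w)`; it vanishes on the negative axis. -/
def binomStep (w : ℂ) (t : ℝ) : ℂ :=
  if 0 ≤ t then altBinom (-w) ⌊t⌋₊ else 0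

theorem measurable_binomStep (w : ℂ) : Measurable (binomStep w) :=
  Measurable.ite measurableSet_Ici ((measurable_from_nat (f := altBinom (-w))).comp
    Nat.measurable_floor) measurable_const

/-- The backward difference of order `w` maps `binomStep w` to the indicator of `[0, 1)`,
because `(1 - x)^w (1 - x)^(-w) = 1`. -/
theorem hasSum_altBinom_mul_binomStep (w : ℂ) (t : ℝ) :
    HasSum (fun k : ℕ => altBinom w k * binomStep w (t - k))
      ((Set.Ico (0 : ℝ) 1).indicator 1 t) := by
  rcases lt_or_ge t 0 with ht | ht
  · rw [Set.indicator_of_notMem fun h => not_le.2 ht h.1]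
    convert hasSum_zero with k
    have : t - k < 0 := by linarith [(Nat.cast_nonneg k : (0 : ℝ) ≤ k)]
    rw [binomStep, if_neg (not_le.2 this), mul_zero]
  · have h := hasSum_sum_of_ne_finset_zero (L := .unconditional ℕ)
      (f := fun k : ℕ => altBinom w k * binomStep w (t - k))
      (s := Finset.range (⌊t⌋₊ + 1)) fun k hk => by
        have : t < k := (Nat.floor_lt ht).1 (by simpa [Nat.lt_succ_iff] using hk)
        rw [binomStep, if_neg (by linarith), mul_zero]
    convert h using 1
    have h2 : ∑ k ∈ Finset.range (⌊t⌋₊ + 1), altBinom w k * binomStep w (t - k) =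
        ∑ k ∈ Finset.range (⌊t⌋₊ + 1), altBinom w k * altBinom (-w) (⌊t⌋₊ - k) := by
      refine Finset.sum_congr rfl fun k hk => ?_
      have : (k : ℝ) ≤ t :=
        (Nat.le_floor_iff ht).1 (Nat.lt_succ_iff.1 (Finset.mem_range.1 hk))
      rw [binomStep, if_pos (sub_nonneg.2 this), Nat.floor_sub_natCast]
    rw [h2, ← Finset.Nat.sum_antidiagonal_eq_sum_range_succ
      (fun i j => altBinom w i * altBinom (-w) j), sum_antidiagonal_altBinom, add_neg_cancel,
      altBinom_zero_left, Set.indicator_apply]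
    simp [Nat.floor_eq_zero, ht]

theorem integrable_truncPow_sub_binomStep {w : ℂ} (hw : 0 < w.re) (hw1 : w.re < 1) :
    Integrable fun t => truncPow (w - 1) t - binomStep w t := by
  have hmeas : Measurable fun t => truncPow (w - 1) t - binomStep w t :=
    (measurable_truncPow _).sub (measurable_binomStep w)
  have hG := Complex.Gamma_ne_zero_of_re_pos hw
  have hneg : IntegrableOn (fun t => truncPow (w - 1) t - binomStep w t) (Set.Iio 0) :=
    integrableOn_zero.congr_fun (fun t (ht : t < 0) => by
      simp [truncPow_of_nonpos _ ht.le, binomStep, not_le.2 ht]) measurableSet_Iio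
  have hmid : IntegrableOn (fun t => truncPow (w - 1) t - binomStep w t) (Set.Ico 0 1) := by
    rw [integrableOn_Ico_iff_integrableOn_Ioo]
    have h1 : IntegrableOn (fun t : ℝ => (t : ℂ) ^ (w - 1)) (Set.Ioo 0 1) :=
      (intervalIntegral.integrableOn_Ioo_cpow_iff one_pos).2 (by simp; linarith)
    have h2 : IntegrableOn (fun _ : ℝ => (1 : ℂ)) (Set.Ioo 0 1) := integrableOn_const (by simp)
    refine IntegrableOn.congr_fun ((h1.div_const (Complex.Gamma w)).sub h2) (fun t ht => ?_)
      measurableSet_Ioo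
    have : ⌊t⌋₊ = 0 := Nat.floor_eq_zero.2 ht.2
    simp [truncPow_of_pos _ ht.1, binomStep, ht.1.le, this, altBinom]
  have hfar : IntegrableOn (fun t => truncPow (w - 1) t - binomStep w t) (Set.Ici 1) := by
    obtain ⟨C, hC⟩ := exists_norm_cpow_sub_altBinom_le hw hw1
    have hb : IntegrableOn (fun t : ℝ => C / ‖Complex.Gamma w‖ * t ^ (w.re - 2)) (Set.Ici 1) :=
      ((integrableOn_Ici_iff_integrableOn_Ioi (by simp)).2
        (integrableOn_Ioi_rpow_of_lt (by linarith) one_pos)).const_mul _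
    refine Integrable.mono' hb hmeas.aestronglyMeasurable
      ((ae_restrict_iff' measurableSet_Ici).2 (ae_of_all _ fun t ht => ?_))
    have ht1 : (1 : ℝ) ≤ t := ht
    have : truncPow (w - 1) t - binomStep w t =
        ((t : ℂ) ^ (w - 1) - Complex.Gamma w * altBinom (-w) ⌊t⌋₊) / Complex.Gamma w := by
      rw [truncPow_of_pos _ (by linarith), binomStep, if_pos (by linarith), sub_add_cancel]
      field_simp
    rw [this, norm_div, div_mul_eq_mul_div]
    gcongr
    exact hC t ht1
  rw [← integrableOn_univ, ← Set.Iio_union_Ici (a := (0 : ℝ)),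
    ← Set.Ico_union_Ici_eq_Ici zero_le_one]
  exact hneg.union (hmid.union hfar)

/-- For small degrees the B-spline is, up to the indicator of `[0, 1)`, the combination with
absolutely summable coefficients of translates of one integrable function. -/
theorem integrable_complexBSpline_of_re_lt {w : ℂ} (hw : 0 < w.re) (hw1 : w.re < 1) :
    Integrable (complexBSpline (w - 1)) := by
  have hE := integrable_truncPow_sub_binomStep hw hw1
  have hdiff : Integrable fun t =>
      complexBSpline (w - 1) t - (Set.Ico (0 : ℝ) 1).indicator (1 : ℝ → ℂ) t := by
    refine integrable_of_hasSum
      (F := fun k t => altBinom w k * (truncPow (w - 1) (t - k) - binomStep w (t - k)))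
      (fun k => (hE.comp_sub_right (k : ℝ)).const_mul _) ?_ fun t => ?_
    · simp_rw [norm_mul, integral_const_mul]
      have : ∀ k : ℕ, ∫ t : ℝ, ‖truncPow (w - 1) (t - k) - binomStep w (t - k)‖ =
          ∫ t : ℝ, ‖truncPow (w - 1) t - binomStep w t‖ := fun k =>
        integral_sub_right_eq_self (fun t => ‖truncPow (w - 1) t - binomStep w t‖) (k : ℝ)
      simp_rw [this]
      exact (summable_norm_altBinom hw).mul_right _
    · obtain ⟨N, hN⟩ := exists_nat_ge t
      have h := hasSum_complexBSpline (w - 1) hN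
      rw [← complexBSpline_eq_sum (w - 1) hN, sub_add_cancel] at h
      simpa only [mul_sub] using h.sub (hasSum_altBinom_mul_binomStep w t)
  have hind : Integrable ((Set.Ico (0 : ℝ) 1).indicator (1 : ℝ → ℂ)) :=
    (integrable_indicator_iff measurableSet_Ico).2 (integrableOn_const (by simp) (C := (1 : ℂ)))
  exact (hdiff.add hind).congr (ae_of_all _ fun t => sub_add_cancel _ _)

theorem integrable_complexBSpline {z : ℂ} (hz : -1 < z.re) : Integrable (complexBSpline z) := by
  -- a degree with `z.re + 1 < m` is split by the semigroup property into `m` small ones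
  have key : ∀ m : ℕ, 1 ≤ m → ∀ w : ℂ, 0 < w.re → w.re < m →
      Integrable (complexBSpline (w - 1)) := by
    intro m hm
    induction m, hm using Nat.le_induction with
    | base => exact fun w hw hw1 => integrable_complexBSpline_of_re_lt hw (by simpa using hw1)
    | succ m hm ih =>
      intro w hw hwm
      have hm0 : (0 : ℝ) < m := by exact_mod_cast hm
      set a : ℝ := 1 / (m + 1) with ha
      have ha0 : 0 < a := by positivity
      have ha1 : 1 - a = m * a := by rw [ha]; field_simp; ring
      push_cast at hwm
      have hr1 : ((a : ℂ) * w).re = a * w.re := Complex.re_ofReal_mul a w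
      have hr2 : (((1 - a : ℝ) : ℂ) * w).re = (1 - a) * w.re := Complex.re_ofReal_mul _ w
      have hlt : a * w.re < 1 := by
        rw [ha, one_div_mul_eq_div, div_lt_one (by positivity)]
        exact hwm
      have h1 := integrable_complexBSpline_of_re_lt (w := a * w) (by rw [hr1]; positivity)
        (by rw [hr1]; exact hlt)
      have h2 := ih ((1 - a : ℝ) * w) (by rw [hr2, ha1]; positivity) (by
        rw [hr2, ha1, mul_assoc]
        exact mul_lt_of_lt_one_right hm0 hlt)
      have h3 := h1.integrable_convolution (ContinuousLinearMap.mul ℝ ℂ) h2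
      refine h3.congr (ae_of_all _ fun t => ?_)
      simp only [convolution_def, ContinuousLinearMap.mul_apply']
      rw [integral_complexBSpline_mul_complexBSpline]
      · congr 1
        push_cast
        ring
      · rw [Complex.sub_re, hr1, Complex.one_re]
        linarith [mul_pos ha0 hw]
      · rw [Complex.sub_re, hr2, ha1, Complex.one_re]
        linarith [mul_pos (mul_pos hm0 ha0) hw]
  obtain ⟨m, hm⟩ := exists_nat_gt (z.re + 1)
  have hm1 : 1 ≤ m := by
    have : (0 : ℝ) < m := by linarith
    exact_mod_cast this
  simpa using key m hm1 (z + 1) (by simp; linarith) (by simpa using hm)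

/-! ### Images of finite complex measures as tempered distributions -/

theorem integrable_mul_schwartzMap_comp {X E : Type*} [MeasurableSpace X] {μ : Measure X}
    [NormedAddCommGroup E] [NormedSpace ℝ E] [MeasurableSpace E] [BorelSpace E]
    {f : X → ℂ} (hf : Integrable f μ) {g : X → E} (hg : Measurable g) (φ : 𝓢(E, ℂ)) :
    Integrable (fun x => f x * φ (g x)) μ :=
  hf.mul_bdd (c := SchwartzMap.seminorm ℝ 0 0 φ)
    (φ.continuous.measurable.comp hg).aestronglyMeasurable
    (ae_of_all _ fun x => φ.norm_le_seminorm ℝ (g x))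

/-- The tempered distribution `φ ↦ ∫ f(x) φ(g(x)) dμ(x)`, i.e. the image under `g` of the finite
complex measure `f μ`. -/
def imageDistrib {X E : Type*} [MeasurableSpace X] {μ : Measure X}
    [NormedAddCommGroup E] [NormedSpace ℝ E] [MeasurableSpace E] [BorelSpace E]
    {f : X → ℂ} (hf : Integrable f μ) {g : X → E} (hg : Measurable g) : 𝓢'(E, ℂ) :=
  ContinuousLinearMap.toPointwiseConvergenceCLM _ _ _ _
    (SchwartzMap.mkCLMtoNormedSpace (𝕜 := ℂ) (σ := RingHom.id ℂ) (fun φ => ∫ x, f x * φ (g x) ∂μ)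
      (fun φ ψ => by
        simp only [_root_.add_apply, mul_add]
        exact integral_add (integrable_mul_schwartzMap_comp hf hg φ)
          (integrable_mul_schwartzMap_comp hf hg ψ))
      (fun a φ => by
        simp only [_root_.smul_apply, smul_eq_mul, RingHom.id_apply, mul_left_comm _ a]
        exact integral_const_mul _ _)
      ⟨{(0, 0)}, ∫ x, ‖f x‖ ∂μ, integral_nonneg fun _ => norm_nonneg _, fun φ => by
        rw [Finset.sup_singleton, ← integral_mul_const]
        refine (norm_integral_le_integral_norm _).trans (integral_mono_of_nonneg
          (ae_of_all _ fun _ => norm_nonneg _) (hf.norm.mul_const _) (ae_of_all _ fun x => ?_))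
        simp only [norm_mul]
        gcongr
        exact φ.norm_le_seminorm ℂ (g x)⟩)

theorem imageDistrib_apply {X E : Type*} [MeasurableSpace X] {μ : Measure X}
    [NormedAddCommGroup E] [NormedSpace ℝ E] [MeasurableSpace E] [BorelSpace E]
    {f : X → ℂ} (hf : Integrable f μ) {g : X → E} (hg : Measurable g) (φ : 𝓢(E, ℂ)) :
    imageDistrib hf hg φ = ∫ x, f x * φ (g x) ∂μ := rfl

/-! ### Box splines -/

theorem measurable_toLp_mulVec {d n : ℕ} (M : Matrix (Fin d) (Fin n) ℝ) :
    Measurable fun t : Fin n → ℝ => WithLp.toLp 2 (M.mulVec t) := by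
  refine Continuous.measurable ?_
  fun_prop

theorem integrable_tensorBSpline {n : ℕ} {z : Fin n → ℂ} (hz : ∀ j, -1 < (z j).re) :
    Integrable (tensorBSpline z) :=
  Integrable.fintype_prod fun j => integrable_complexBSpline (hz j)

theorem tensorBSpline_of_notMem {n : ℕ} (z : Fin n → ℂ) {t : Fin n → ℝ}
    (ht : t ∉ Set.Ici (0 : Fin n → ℝ)) : tensorBSpline z t = 0 := by
  obtain ⟨j, hj⟩ : ∃ j, t j < 0 := by simpa [Pi.le_def] using ht
  exact Finset.prod_eq_zero (Finset.mem_univ j) (complexBSpline_of_nonpos _ hj.le)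

/-- The defining integral of a box spline over the cone `ℝ_+^n` is an integral over `ℝ^n`, since
the B-splines vanish on the negative axis. -/
theorem setIntegral_tensorBSpline_mul {n : ℕ} (z : Fin n → ℂ) (G : (Fin n → ℝ) → ℂ) :
    ∫ t in Set.Ici 0, tensorBSpline z t * G t = ∫ t, tensorBSpline z t * G t :=
  setIntegral_eq_integral_of_forall_compl_eq_zero fun t ht => by
    rw [tensorBSpline_of_notMem z ht, zero_mul]

theorem isWeightedTruncatedPower_complexBoxSpline {d n : ℕ} (M : Matrix (Fin d) (Fin n) ℝ)
    {z : Fin n → ℂ} (hz : ∀ j, -1 < (z j).re) :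
    IsWeightedTruncatedPower (tensorBSpline z) M (complexBoxSpline z M) := by
  have h : ∃ T, IsWeightedTruncatedPower (tensorBSpline z) M T :=
    ⟨imageDistrib (integrable_tensorBSpline hz) (measurable_toLp_mulVec M), fun φ =>
      ⟨(integrable_mul_schwartzMap_comp (integrable_tensorBSpline hz)
        (measurable_toLp_mulVec M) φ).integrableOn, by
        rw [setIntegral_tensorBSpline_mul z, imageDistrib_apply]⟩⟩
  rw [complexBoxSpline, weightedTruncatedPower, dif_pos h]
  exact h.choose_spec

theorem complexBoxSpline_apply {d n : ℕ} (M : Matrix (Fin d) (Fin n) ℝ) {z : Fin n → ℂ}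
    (hz : ∀ j, -1 < (z j).re) (φ : 𝓢(EuclideanSpace ℝ (Fin d), ℂ)) :
    complexBoxSpline z M φ = ∫ t, tensorBSpline z t * φ (WithLp.toLp 2 (M.mulVec t)) := by
  rw [(isWeightedTruncatedPower_complexBoxSpline M hz φ).2, setIntegral_tensorBSpline_mul z]

theorem distribTranslate_apply {E : Type*} [NormedAddCommGroup E] [NormedSpace ℝ E] (a : E)
    (T : 𝓢'(E, ℂ)) (φ : 𝓢(E, ℂ)) :
    distribTranslate a T φ = T (SchwartzMap.compSubConstCLM ℂ (-a) φ) := rfl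

theorem toLp_mulVec_eq_add {d n : ℕ} (M : Matrix (Fin d) (Fin (n + 1)) ℝ) (t : Fin (n + 1) → ℝ) :
    WithLp.toLp 2 (M.mulVec t) =
      WithLp.toLp 2 ((M.submatrix id Fin.castSucc).mulVec (Fin.init t)) +
        t (Fin.last n) • WithLp.toLp 2 (M.col (Fin.last n)) := by
  ext i
  simp [Matrix.mulVec, dotProduct, Fin.sum_univ_castSucc, Fin.init, mul_comm]

/-- The recurrence formula: Fubini's theorem for the splitting `ℝ^(n+1) = ℝ × ℝ^n` which
separates the last coordinate. -/
theorem isDistribIntegral_complexBoxSpline {d n : ℕ} (M : Matrix (Fin d) (Fin (n + 1)) ℝ)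
    {z : Fin (n + 1) → ℂ} (hz : ∀ j, -1 < (z j).re) :
    IsDistribIntegral (Set.Ici (0 : ℝ))
      (fun u => complexBSpline (z (Fin.last n)) u •
        distribTranslate (u • WithLp.toLp 2 (M.col (Fin.last n)))
          (complexBoxSpline (Fin.init z) (M.submatrix id Fin.castSucc)))
      (complexBoxSpline z M) := by
  intro φ
  have hz' : ∀ j, -1 < (Fin.init z j).re := fun j => hz j.castSucc
  set m := WithLp.toLp 2 (M.col (Fin.last n)) with hm
  let g : ℝ × (Fin n → ℝ) → EuclideanSpace ℝ (Fin d) := fun p =>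
    WithLp.toLp 2 ((M.submatrix id Fin.castSucc).mulVec p.2) + p.1 • m
  have hg : Measurable g := ((measurable_toLp_mulVec _).comp measurable_snd).add
    (measurable_fst.smul_const m)
  have hF : Integrable (fun p : ℝ × (Fin n → ℝ) =>
      complexBSpline (z (Fin.last n)) p.1 * tensorBSpline (Fin.init z) p.2 * φ (g p))
      (volume.prod volume) :=
    integrable_mul_schwartzMap_comp
      ((integrable_complexBSpline (hz _)).mul_prod (integrable_tensorBSpline hz')) hg φ
  have happly : ∀ u : ℝ, (complexBSpline (z (Fin.last n)) u • distribTranslate (u • m)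
      (complexBoxSpline (Fin.init z) (M.submatrix id Fin.castSucc))) φ =
      ∫ t, complexBSpline (z (Fin.last n)) u * tensorBSpline (Fin.init z) t * φ (g (u, t)) := by
    intro u
    simp_rw [mul_assoc]
    rw [integral_const_mul]
    change complexBSpline (z (Fin.last n)) u * distribTranslate (u • m) _ φ = _
    rw [distribTranslate_apply, complexBoxSpline_apply _ hz']
    simp [g]
  simp_rw [happly]
  refine ⟨hF.integral_prod_left.integrableOn, ?_⟩
  rw [setIntegral_eq_integral_of_forall_compl_eq_zero fun u hu => by
      simp [complexBSpline_of_nonpos _ (not_le.1 hu).le],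
    complexBoxSpline_apply M hz, ← integral_prod _ hF,
    ← Measure.volume_eq_prod, ← (volume_preserving_piFinSuccAbove (fun _ : Fin (n + 1) => ℝ)
      (Fin.last n)).integral_comp']
  refine integral_congr_ae (ae_of_all _ fun t => ?_)
  simp only [MeasurableEquiv.piFinSuccAbove_apply, Fin.insertNthEquiv_symm_apply,
    Fin.removeNth_last, g]
  rw [toLp_mulVec_eq_add, tensorBSpline, Fin.prod_univ_castSucc, mul_comm (∏ _, _)]
  rfl

/-- The tensor product B-splines form a semigroup under convolution, tested here against a bounded
function. -/
theorem integral_tensorBSpline_mul_add {n : ℕ} {z w : Fin n → ℂ} (hz : ∀ j, -1 < (z j).re)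
    (hw : ∀ j, -1 < (w j).re) {G : (Fin n → ℝ) → ℂ} (hG : Measurable G) {C : ℝ}
    (hC : ∀ t, ‖G t‖ ≤ C) :
    ∫ p : (Fin n → ℝ) × (Fin n → ℝ), tensorBSpline z p.1 * tensorBSpline w p.2 * G (p.1 + p.2) =
      ∫ u, tensorBSpline (fun j => z j + w j + 1) u * G u := by
  have hint : Integrable (fun p : (Fin n → ℝ) × (Fin n → ℝ) =>
      tensorBSpline z p.1 * tensorBSpline w p.2 * G (p.1 + p.2)) (volume.prod volume) :=
    ((integrable_tensorBSpline hz).mul_prod (integrable_tensorBSpline hw)).mul_bdd (c := C)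
      (hG.comp (measurable_fst.add measurable_snd)).aestronglyMeasurable
      (ae_of_all _ fun _ => hC _)
  have hconv : Integrable (fun p : (Fin n → ℝ) × (Fin n → ℝ) =>
      tensorBSpline z p.2 * tensorBSpline w (p.1 - p.2) * G p.1) (volume.prod volume) :=
    ((integrable_tensorBSpline hz).convolution_integrand (ContinuousLinearMap.mul ℝ ℂ)
      (integrable_tensorBSpline hw)).mul_bdd (c := C)
      (hG.comp measurable_fst).aestronglyMeasurable (ae_of_all _ fun _ => hC _)
  rw [Measure.volume_eq_prod, integral_prod _ hint]
  have hshift : ∀ s : Fin n → ℝ, ∫ t, tensorBSpline z s * tensorBSpline w t * G (s + t) =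
      ∫ u, tensorBSpline z s * tensorBSpline w (u - s) * G u := by
    intro s
    rw [← integral_add_left_eq_self
      (fun u => tensorBSpline z s * tensorBSpline w (u - s) * G u) s]
    simp
  simp_rw [hshift]
  rw [integral_integral_swap
    (f := fun s u => tensorBSpline z s * tensorBSpline w (u - s) * G u) hconv.swap]
  refine integral_congr_ae (ae_of_all _ fun u => ?_)
  simp only
  rw [integral_mul_const]
  congr 1
  simp only [tensorBSpline, Pi.sub_apply, ← Finset.prod_mul_distrib]
  rw [integral_fintype_prod_volume_eq_prod
    (fun j s => complexBSpline (z j) s * complexBSpline (w j) (u j - s))]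
  exact Finset.prod_congr rfl fun j _ =>
    integral_complexBSpline_mul_complexBSpline (hz j) (hw j) (u j)

theorem isDistribTensor_imageDistrib {X Y E : Type*} [MeasurableSpace X] [MeasurableSpace Y]
    {μ : Measure X} {ν : Measure Y} [SFinite μ] [SFinite ν] [NormedAddCommGroup E]
    [NormedSpace ℝ E] [MeasurableSpace E] [BorelSpace E] [SecondCountableTopology E]
    {f : X → ℂ} {g : Y → ℂ} (hf : Integrable f μ) (hg : Integrable g ν) {a : X → E} {b : Y → E}
    (ha : Measurable a) (hb : Measurable b) :
    IsDistribTensor (imageDistrib hf ha) (imageDistrib hg hb)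
      (imageDistrib (hf.mul_prod hg) (ha.prodMap hb)) := by
  intro φ ψ θ hθ
  simp only [imageDistrib_apply]
  rw [← integral_prod_mul]
  refine integral_congr_ae (ae_of_all _ fun p => ?_)
  simp only [Prod.map, hθ]
  ring

/-- The convolution formula: the tensor product is integration against a finite complex measure,
so that the cutoffs can be removed by dominated convergence. -/
theorem isConvolution_complexBoxSpline {d n : ℕ} (M : Matrix (Fin d) (Fin n) ℝ) {z w : Fin n → ℂ}
    (hz : ∀ j, -1 < (z j).re) (hw : ∀ j, -1 < (w j).re) :
    IsConvolution (complexBoxSpline z M) (complexBoxSpline w M)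
      (complexBoxSpline (fun j => z j + w j + 1) M) := by
  have hzw : ∀ j, -1 < (z j + w j + 1).re := fun j => by
    simp only [Complex.add_re, Complex.one_re]
    linarith [hz j, hw j]
  have hA := measurable_toLp_mulVec M
  have heq : ∀ {v : Fin n → ℂ} (hv : ∀ j, -1 < (v j).re),
      complexBoxSpline v M = imageDistrib (integrable_tensorBSpline hv) hA := fun hv => by
    ext φ
    rw [complexBoxSpline_apply M hv, imageDistrib_apply]
  have hf := (integrable_tensorBSpline hz).mul_prod (integrable_tensorBSpline hw)
  refine ⟨imageDistrib hf (hA.prodMap hA), ?_, fun η hη φ => ?_⟩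
  · rw [heq hz, heq hw]
    exact isDistribTensor_imageDistrib _ _ hA hA
  obtain ⟨C, hC⟩ := hη.bounded 0
  have hC' : ∀ k p, ‖η k p‖ ≤ C := fun k p => by simpa using hC k p
  have hlim : complexBoxSpline (fun j => z j + w j + 1) M φ =
      ∫ p : (Fin n → ℝ) × (Fin n → ℝ), tensorBSpline z p.1 * tensorBSpline w p.2 *
        φ (WithLp.toLp 2 (M.mulVec p.1) + WithLp.toLp 2 (M.mulVec p.2)) := by
    have h := integral_tensorBSpline_mul_add hz hw (φ.continuous.measurable.comp hA)
      fun t => φ.norm_le_seminorm ℝ _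
    simp only [Function.comp_apply, Matrix.mulVec_add, WithLp.toLp_add] at h
    rw [complexBoxSpline_apply M hzw, h]
  rw [hlim]
  simp only [imageDistrib_apply]
  refine tendsto_integral_of_dominated_convergence
    (fun p => ‖tensorBSpline z p.1 * tensorBSpline w p.2‖ * (C * SchwartzMap.seminorm ℝ 0 0 φ))
    (fun k => (integrable_mul_schwartzMap_comp hf (hA.prodMap hA) _).1)
    (hf.norm.mul_const _) (fun k => ae_of_all _ fun p => ?_) (ae_of_all _ fun p => ?_)
  · rw [norm_mul]
    gcongr
    change ‖η k _ * φ _‖ ≤ _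
    rw [norm_mul]
    exact mul_le_mul (hC' k _) (φ.norm_le_seminorm ℝ _) (norm_nonneg _)
      ((norm_nonneg _).trans (hC' k 0))
  · refine tendsto_const_nhds.congr' ?_
    filter_upwards [hη.eventually_one _ (isCompact_singleton
      (x := Prod.map (fun t => WithLp.toLp 2 (M.mulVec t)) (fun t => WithLp.toLp 2 (M.mulVec t))
        p))] with k hk
    change _ = _ * (η k _ * φ _)
    rw [hk _ rfl, one_mul]
    rfl

end

theorem mainTheorem3 {d n : ℕ} (M : Matrix (Fin d) (Fin (n + 1)) ℝ) (hM : IsDirectionSet M) :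
    (∀ z : Fin (n + 1) → ℂ, (∀ j, -1 < (z j).re) →
      IsWeightedTruncatedPower (tensorBSpline z) M (complexBoxSpline z M) ∧
      IsWeightedTruncatedPower (tensorBSpline (Fin.init z)) (M.submatrix id Fin.castSucc)
        (complexBoxSpline (Fin.init z) (M.submatrix id Fin.castSucc)) ∧
      IsDistribIntegral (Set.Ici (0 : ℝ))
        (fun u => complexBSpline (z (Fin.last n)) u •
          distribTranslate (u • WithLp.toLp 2 (M.col (Fin.last n)))
            (complexBoxSpline (Fin.init z) (M.submatrix id Fin.castSucc)))
        (complexBoxSpline z M)) ∧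
    (∀ z w : Fin (n + 1) → ℂ, (∀ j, -1 < (z j).re) → (∀ j, -1 < (w j).re) →
      IsConvolution (complexBoxSpline z M) (complexBoxSpline w M)
        (complexBoxSpline (fun j => z j + w j + 1) M)) :=
  ⟨fun _ hz => ⟨isWeightedTruncatedPower_complexBoxSpline M hz,
    isWeightedTruncatedPower_complexBoxSpline _ fun j => hz j.castSucc,
    isDistribIntegral_complexBoxSpline M hz⟩,
    fun _ _ hz hw => isConvolution_complexBoxSpline M hz hw⟩
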